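/- Let $X$ be a Tychonoff space, and let $C_p(X)$ be the space of continuous real-valued functions on $X$ with the topology of pointwise convergence. Let $c_0=\{(x_n)\in\mathbb R^{\mathbb N}: x_n\to 0\}$ carry the topology inherited from the product $\mathbb R^{\mathbb N}$. A locally convex space $E$ is called Polishable if there is a locally convex topology on $E$, stronger than or equal to the original one, in which $E$ is a separable Fréchet space (that is, separable, metrizable and complete). A quotient of $C_p(X)$ is a space $C_p(X)/Z$ with the quotient topology, where $Z$ is a closed linear subspace. A linear subspace $S$ of $C_p(X)$ is complemented if there is a continuous linear projection of $C_p(X)$ onto $S$; isomorphic means linearly homeomorphic. The space $X$ is pseudocompact if every continuous real-valued function on $X$ is bounded. The space $C_p(X)$ has the Josefson–Nissenzweig property (JNP) if there is a sequence $\mu_n=\sum_{x\in F_n}\alpha_{n,x}\delta_x$ of finitely supported sign-measures on $X$ (with $F_n\subset X$ finite and $\alpha_{n,x}\in\mathbb R$) such that $\|\mu_n\|=\sum_{x\in F_n}|\alpha_{n,x}|=1$ for all $n$ and $\mu_n(f)=\sum_{x\in F_n}\alpha_{n,x}f(x)\to 0$ for every $f\in C_p(X)$. Then the following conditions are equivalent: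 1. $C_p(X)$ has an infinite-dimensional Polishable quotient; 2. $C_p(X)$ contains a complemented infinite-dimensional Polishable subspace; 3. $C_p(X)$ contains a complemented subspace isomorphic to $\mathbb R^{\mathbb N}$ or to $c_0$; 4. $X$ is not pseudocompact or $C_p(X)$ has the JNP. -/

import Mathlib

open Filter Topology

/-- `Cp X`: the real-valued continuous functions on `X`, as a linear subspace of `X → ℝ`.
As a type it carries the subspace topology of the product topology, that is, the topology of
pointwise convergence. -/
abbrev Cp (X : Type*) [TopologicalSpace X] : Submodule ℝ (X → ℝ) where
  carrier := {f | Continuous f}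
  add_mem' := fun hf hg => Continuous.add hf hg
  zero_mem' := continuous_const
  smul_mem' := fun c _ hf => Continuous.const_smul hf c

/-- `cZero`: the real sequences converging to zero, as a linear subspace of `ℝ^ℕ`.
As a type it carries the subspace topology of the product topology (not the sup norm). -/
abbrev cZero : Submodule ℝ (ℕ → ℝ) where
  carrier := {x | Tendsto x atTop (𝓝 0)}
  add_mem' := fun {x y} (hx : Tendsto x atTop (𝓝 0)) (hy : Tendsto y atTop (𝓝 0)) =>
    show Tendsto (fun n => x n + y n) atTop (𝓝 0) by simpa using hx.add hy
  zero_mem' := tendsto_const_nhds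
  smul_mem' := fun c x (hx : Tendsto x atTop (𝓝 0)) =>
    show Tendsto (fun n => c * x n) atTop (𝓝 0) by simpa using hx.const_mul c

/-- A Tychonoff space on which every continuous real-valued function is bounded. -/
structure IsPseudocompactSpace (X : Type*) [TopologicalSpace X] : Prop where
  tychonoff : T35Space X
  bounded : ∀ f : X → ℝ, Continuous f → ∃ M : ℝ, ∀ x, |f x| ≤ M

/-- A separable Fréchet space: a real locally convex topological vector space which is
metrizable, separable, and complete (for its uniform structure as an additive group; for a
topological vector space this uniform structure is determined by the topology). -/
structure IsSeparableFrechet (E : Type*) [AddCommGroup E] [Module ℝ E] [UniformSpace E] :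
    Prop where
  uniformAddGroup : IsUniformAddGroup E
  continuousSMul : ContinuousSMul ℝ E
  locallyConvex : LocallyConvexSpace ℝ E
  metrizable : TopologicalSpace.MetrizableSpace E
  complete : CompleteSpace E
  separable : TopologicalSpace.SeparableSpace E

/-- A topological vector space `E` is Polishable if there is a topology on `E`, stronger than (or
equal to) the given one, which makes `E` a separable Fréchet space. In Mathlib's order
on topologies `τ₁ ≤ τ₂` means that `τ₁` is finer. -/
def IsPolishable (E : Type*) [AddCommGroup E] [Module ℝ E] [τ : TopologicalSpace E] : Prop :=
  ∃ u : UniformSpace E, u.toTopologicalSpace ≤ τ ∧ @IsSeparableFrechet E _ _ u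

/-- A finitely supported sign-measure `∑ αₓ δₓ` on `X` is given by its finitely supported family of
coefficients `α : X →₀ ℝ`; this is its norm `∑ |αₓ|`. -/
noncomputable def signMeasureNorm {X : Type*} (μ : X →₀ ℝ) : ℝ :=
  μ.sum fun _ a => |a|

/-- The value `μ(f) = ∑ αₓ f(x)` of the sign-measure `μ = ∑ αₓ δₓ` at the function `f`. -/
noncomputable def signMeasureEval {X : Type*} (μ : X →₀ ℝ) (f : X → ℝ) : ℝ :=
  μ.sum fun x a => a * f x

/-- The Josefson-Nissenzweig property of `Cp X`. -/
def HasJNP (X : Type*) [TopologicalSpace X] : Prop :=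
  ∃ μ : ℕ → X →₀ ℝ, (∀ n, signMeasureNorm (μ n) = 1) ∧
    ∀ f : Cp X, Tendsto (fun n => signMeasureEval (μ n) f) atTop (𝓝 0)

/-! The implications run 3 → 2 → 1 → 4 → 3. For 3 → 2, `ℝ^ℕ` is itself a separable Fréchet space,
and the sup norm refines the pointwise topology of `cZero`. For 2 → 1, divide by the kernel of the
projection.

1 → 4: if every continuous function is bounded, the Banach space `X →ᵇ ℝ` maps bijectively onto `Cp
X`, so a Banach quotient of it maps continuously and bijectively onto `Cp X ⧸ Z`. By the closed
graph theorem the finer Fréchet topology maps continuously back onto the Banach quotient, which is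
therefore separable. A norm-one sign-measure that kills `Z` and the first `n` lifts of a dense
sequence exists for each `n`, because the quotient is infinite-dimensional; these measures witness
the JNP.

4 → 3: both cases need disjointly supported functions `φ n` and a biorthogonal sequence of measures
`ν n`; then `t ↦ ∑ t n φ n` has the left inverse `f ↦ (ν n f)`. An unbounded function gives locally
finite bumps with point evaluations, hence `ℝ^ℕ`. From a JNP sequence, a gliding hump extracts
measures and bumps whose matrix is lower triangular with unit diagonal and small entries below it.
Inverting this matrix keeps the measures null on `Cp X`, hence `c₀`. -/

/-! ### The closed graph theorem on Baire spaces -/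

/-- By Baire some closure of a preimage of a ball has an interior point; subtracting that point and
rescaling moves the neighbourhood to zero. -/
theorem closure_preimage_ball_mem_nhds_zero {E F : Type*} [AddCommGroup E] [Module ℝ E]
    [TopologicalSpace E] [IsTopologicalAddGroup E] [ContinuousSMul ℝ E] [BaireSpace E]
    [NormedAddCommGroup F] [NormedSpace ℝ F] (f : E →ₗ[ℝ] F) {ε : ℝ} (hε : 0 < ε) :
    closure (f ⁻¹' Metric.ball 0 ε) ∈ 𝓝 (0 : E) := by
  have hU : ⋃ n : ℕ, closure (f ⁻¹' Metric.ball 0 (n : ℝ)) = Set.univ := by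
    refine Set.eq_univ_of_forall fun x => Set.mem_iUnion.2 ?_
    obtain ⟨n, hn⟩ := exists_nat_gt ‖f x‖
    exact ⟨n, subset_closure (by simpa using hn)⟩
  obtain ⟨n, x, hx⟩ := nonempty_interior_of_iUnion_of_closed (fun n => isClosed_closure) hU
  rw [mem_interior_iff_mem_nhds] at hx
  have hx' := mem_of_mem_nhds hx
  rw [← map_add_left_nhds_zero, mem_map] at hx
  have h2 : closure (f ⁻¹' Metric.ball 0 ((n : ℝ) + n)) ∈ 𝓝 (0 : E) := by
    filter_upwards [hx] with y hy
    have hy' : x + y ∈ closure (f ⁻¹' Metric.ball 0 (n : ℝ)) := hy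
    have := map_mem_closure₂ (continuous_sub (G := E)) hy' hx'
      (u := f ⁻¹' Metric.ball 0 ((n : ℝ) + n)) ?_
    · simpa using this
    · intro a ha b hb
      simp only [Set.mem_preimage, mem_ball_zero_iff, map_sub] at *
      exact (norm_sub_le _ _).trans_lt (add_lt_add ha hb)
  -- The extra 1 keeps `c` positive when `n = 0`.
  set c : ℝ := ((n : ℝ) + n + 1) / ε with hc
  have hc0 : 0 < c := by positivity
  have ht : Tendsto (fun y : E => c • y) (𝓝 0) (𝓝 0) := by
    have : Continuous fun y : E => c • y := continuous_const_smul c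
    simpa using this.tendsto 0
  filter_upwards [ht h2] with y hy
  have hy' : c • y ∈ closure (f ⁻¹' Metric.ball 0 ((n : ℝ) + n)) := hy
  have := map_mem_closure (continuous_const_smul c⁻¹) hy' (t := f ⁻¹' Metric.ball 0 ε) ?_
  · simpa [smul_smul, inv_mul_cancel₀ hc0.ne'] using this
  · intro a ha
    simp only [Set.mem_preimage, mem_ball_zero_iff, map_smul, norm_smul, norm_inv,
      Real.norm_eq_abs, abs_of_pos hc0] at *
    rw [inv_mul_lt_iff₀ hc0, hc, div_mul_cancel₀ _ hε.ne']
    linarith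

/-- The closed graph theorem for linear maps from a first countable Baire topological vector
space to a Banach space. -/
theorem LinearMap.continuous_of_isClosed_graph_of_baireSpace {E F : Type*} [AddCommGroup E]
    [Module ℝ E] [TopologicalSpace E] [IsTopologicalAddGroup E] [ContinuousSMul ℝ E]
    [BaireSpace E] [FirstCountableTopology E] [NormedAddCommGroup F] [NormedSpace ℝ F]
    [CompleteSpace F] (f : E →ₗ[ℝ] F) (hf : IsClosed {p : E × F | f p.1 = p.2}) :
    Continuous f := by
  -- The closure is removed by successive approximation: the remainders `r n` tend to zero while the
  -- increments of `f (r n)` are bounded by a geometric series of sum `ε`.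
  have key : ∀ ε : ℝ, 0 < ε → ∀ x ∈ closure (f ⁻¹' Metric.ball 0 (ε / 2)), ‖f x‖ ≤ ε := by
    intro ε hε x hx
    obtain ⟨V, hV⟩ := (𝓝 (0 : E)).exists_antitone_basis
    have hpos : ∀ n : ℕ, 0 < ε / 2 / 2 ^ n := fun n => by positivity
    have step : ∀ n : ℕ, ∀ r ∈ closure (f ⁻¹' Metric.ball 0 (ε / 2 / 2 ^ n)),
        ∃ r' ∈ closure (f ⁻¹' Metric.ball 0 (ε / 2 / 2 ^ (n + 1))),
          r' ∈ V n ∧ ‖f r - f r'‖ ≤ ε / 2 / 2 ^ n := by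
      intro n r hr
      have hW : closure (f ⁻¹' Metric.ball 0 (ε / 2 / 2 ^ (n + 1))) ∩ V n ∈ 𝓝 (r - r) := by
        rw [sub_self]
        exact inter_mem (closure_preimage_ball_mem_nhds_zero f (hpos _)) (hV.mem n)
      have ht : Tendsto (fun a => r - a) (𝓝 r) (𝓝 (r - r)) :=
        (continuous_const.sub continuous_id).tendsto r
      obtain ⟨a, ha, ha'⟩ := mem_closure_iff_nhds.1 hr _ (ht hW)
      refine ⟨r - a, ha.1, ha.2, ?_⟩
      simp only [Set.mem_preimage, mem_ball_zero_iff] at ha'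
      simpa using ha'.le
    choose! g hg hgV hgn using step
    let r : ℕ → E := fun n => Nat.rec x g n
    have hr : ∀ n, r n ∈ closure (f ⁻¹' Metric.ball 0 (ε / 2 / 2 ^ n)) := by
      intro n
      induction n with
      | zero => simpa [r] using hx
      | succ n ih => exact hg n _ ih
    have hr0 : Tendsto r atTop (𝓝 0) := by
      rw [← tendsto_add_atTop_iff_nat 1]
      exact hV.tendsto fun n => hgV n _ (hr n)
    have hd : ∀ n, dist (f (r n)) (f (r (n + 1))) ≤ ε / 2 / 2 ^ n := fun n => by
      rw [dist_eq_norm]; exact hgn n _ (hr n)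
    obtain ⟨L, hL⟩ := cauchySeq_tendsto_of_complete (cauchySeq_of_le_geometric_two hd)
    -- The closed graph forces the limit of `f (r n)` to be zero.
    have hL0 : f 0 = L := hf.mem_of_tendsto (hr0.prodMk_nhds hL) (Eventually.of_forall fun n => rfl)
    rw [map_zero] at hL0
    have := dist_le_of_le_geometric_two_of_tendsto₀ hd hL
    rwa [← hL0, dist_zero_right] at this
  refine continuous_of_continuousAt_zero f ?_
  rw [ContinuousAt, map_zero, Metric.tendsto_nhds]
  intro ε hε
  filter_upwards [closure_preimage_ball_mem_nhds_zero f
    (show 0 < ε / 2 / 2 by positivity)] with x hx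
  rw [dist_zero_right]
  linarith [key (ε / 2) (by positivity) x hx]

/-! ### Sign-measures as functionals on `Cp X` -/

theorem signMeasureEval_eq_linearCombination {X : Type*} (μ : X →₀ ℝ) (f : X → ℝ) :
    signMeasureEval μ f = Finsupp.linearCombination ℝ f μ := rfl

theorem signMeasureEval_eq_sum {X : Type*} (μ : X →₀ ℝ) (f : X → ℝ) :
    signMeasureEval μ f = ∑ x ∈ μ.support, μ x * f x := rfl

theorem signMeasureNorm_eq_sum {X : Type*} (μ : X →₀ ℝ) :
    signMeasureNorm μ = ∑ x ∈ μ.support, |μ x| := rfl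

theorem signMeasureNorm_smul {X : Type*} (c : ℝ) (μ : X →₀ ℝ) :
    signMeasureNorm (c • μ) = |c| * signMeasureNorm μ := by
  unfold signMeasureNorm
  rw [Finsupp.sum_smul_index (by simp), Finsupp.sum, Finsupp.sum, Finset.mul_sum]
  simp [abs_mul]

theorem signMeasureNorm_pos {X : Type*} {μ : X →₀ ℝ} (hμ : μ ≠ 0) : 0 < signMeasureNorm μ :=
  Finset.sum_pos (fun _ hx => abs_pos.2 (Finsupp.mem_support_iff.1 hx))
    (Finsupp.support_nonempty_iff.2 hμ)

theorem signMeasureNorm_normalize {X : Type*} {μ : X →₀ ℝ} (hμ : μ ≠ 0) :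
    signMeasureNorm ((signMeasureNorm μ)⁻¹ • μ) = 1 := by
  have := signMeasureNorm_pos hμ
  rw [signMeasureNorm_smul, abs_of_pos (inv_pos.2 this), inv_mul_cancel₀ this.ne']

theorem signMeasureEval_smul {X : Type*} (c : ℝ) (μ : X →₀ ℝ) (f : X → ℝ) :
    signMeasureEval (c • μ) f = c * signMeasureEval μ f := by
  simp [signMeasureEval_eq_linearCombination]

theorem signMeasureEval_sub {X : Type*} (μ ν : X →₀ ℝ) (f : X → ℝ) :
    signMeasureEval (μ - ν) f = signMeasureEval μ f - signMeasureEval ν f := by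
  simp [signMeasureEval_eq_linearCombination]

theorem abs_signMeasureEval_le {X : Type*} (μ : X →₀ ℝ) {f : X → ℝ} {C : ℝ}
    (hf : ∀ x, |f x| ≤ C) : |signMeasureEval μ f| ≤ C * signMeasureNorm μ := by
  rw [signMeasureEval_eq_sum, signMeasureNorm_eq_sum, Finset.mul_sum]
  refine (Finset.abs_sum_le_sum_abs _ _).trans (Finset.sum_le_sum fun x _ => ?_)
  rw [abs_mul, mul_comm]
  exact mul_le_mul_of_nonneg_right (hf x) (abs_nonneg _)

/-- The continuous linear functional on `Cp X` given by a finitely supported sign-measure. -/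
noncomputable def signMeasureCLM {X : Type*} [TopologicalSpace X] (μ : X →₀ ℝ) : Cp X →L[ℝ] ℝ where
  toFun f := signMeasureEval μ f
  map_add' f g := by
    simp [signMeasureEval_eq_sum, mul_add, Finset.sum_add_distrib]
  map_smul' c f := by
    simp [signMeasureEval_eq_sum, Finset.mul_sum, mul_left_comm]
  cont := by
    simp only [signMeasureEval_eq_sum]
    exact continuous_finsetSum _ fun x _ =>
      continuous_const.mul ((continuous_apply x).comp continuous_subtype_val)

theorem signMeasureCLM_apply {X : Type*} [TopologicalSpace X] (μ : X →₀ ℝ) (f : Cp X) :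
    signMeasureCLM μ f = signMeasureEval μ f := rfl

/-- A proper closed subspace of `Cp X` is annihilated by a finitely supported sign-measure of
norm one. -/
theorem exists_signMeasure_of_isClosed {X : Type*} [TopologicalSpace X] {W : Submodule ℝ (Cp X)}
    (hW : IsClosed (W : Set (Cp X))) (hW' : W ≠ ⊤) :
    ∃ μ : X →₀ ℝ, signMeasureNorm μ = 1 ∧ ∀ f ∈ W, signMeasureEval μ f = 0 := by
  obtain ⟨g, hg⟩ : ∃ g, g ∉ W := by
    by_contra! h
    exact hW' (eq_top_iff.2 fun x _ => h x)
  have hn : (W : Set (Cp X))ᶜ ∈ 𝓝 g := hW.isOpen_compl.mem_nhds hg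
  rw [nhds_subtype_eq_comap, mem_comap, nhds_pi] at hn
  obtain ⟨t, ht, htW⟩ := hn
  obtain ⟨I, hI, s, hs, hst⟩ := Filter.mem_pi.1 ht
  classical
  have : Fintype I := hI.fintype
  let ρ : Cp X →ₗ[ℝ] (I → ℝ) := (LinearMap.funLeft ℝ ℝ ((↑) : I → X)).comp (Cp X).subtype
  have hρ : ∀ f x, ρ f x = (f : X → ℝ) x := fun f x => rfl
  -- The neighbourhood of `g` missing `W` constrains only the coordinates in `I`, so an element of
  -- `W` agreeing with `g` on `I` would lie in it. Separation thus takes place in the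
  -- finite-dimensional space `ℝ^I`.
  have hgρ : ρ g ∉ W.map ρ := by
    rintro ⟨w, hw, hwg⟩
    refine htW (a := w) (hst ?_) hw
    intro x hx
    have : (w : X → ℝ) x = (g : X → ℝ) x := congrFun hwg ⟨x, hx⟩
    rw [this]
    exact mem_of_mem_nhds (hs x)
  obtain ⟨φ, hφ, hφW⟩ := Submodule.exists_dual_map_eq_bot_of_notMem hgρ inferInstance
  let μ : X →₀ ℝ := Finsupp.mapDomain (↑)
    ((Finsupp.linearEquivFunOnFinite ℝ ℝ I).symm fun x : I => φ (Pi.single x 1))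
  have hμ : ∀ f : Cp X, signMeasureEval μ f = φ (ρ f) := by
    intro f
    rw [signMeasureEval_eq_linearCombination, Finsupp.linearCombination_mapDomain,
      LinearMap.pi_apply_eq_sum_univ φ (ρ f), Finsupp.linearCombination_eq_fintype_linearCombination_apply ℝ,
      Fintype.linearCombination_apply]
    refine Finset.sum_congr rfl fun x _ => ?_
    simp [hρ, mul_comm, Function.comp]
    left
    congr 1
    ext j
    simp [Pi.single_apply, eq_comm]
  have hμ0 : μ ≠ 0 := by
    intro h0
    apply hφ
    rw [← hμ, h0]
    simp [signMeasureEval_eq_sum]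
  refine ⟨_, signMeasureNorm_normalize hμ0, fun f hf => ?_⟩
  rw [signMeasureEval_smul, hμ]
  have : φ (ρ f) ∈ (W.map ρ).map φ := ⟨_, ⟨f, hf, rfl⟩, rfl⟩
  rw [hφW, Submodule.mem_bot] at this
  rw [this, mul_zero]

/-! ### From Polishable quotients to the JNP -/

theorem IsSeparableFrechet.baireSpace {E : Type*} [AddCommGroup E] [Module ℝ E] [UniformSpace E]
    (hE : IsSeparableFrechet E) : BaireSpace E := by
  have := hE.uniformAddGroup
  have := hE.metrizable
  have := hE.complete
  have := IsUniformAddGroup.uniformity_countably_generated (α := E)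
  infer_instance

/-- A Banach space which is linearly isomorphic to a separable Fréchet space, through a map that is
continuous for a coarser Hausdorff topology, is separable. -/
theorem IsSeparableFrechet.separableSpace_of_linearEquiv {E B G : Type*} [AddCommGroup E]
    [Module ℝ E] [UniformSpace E] (hE : IsSeparableFrechet E) [TopologicalSpace G] [T2Space G]
    {i : E → G} (hi : Continuous i) (hi' : Function.Injective i) [NormedAddCommGroup B]
    [NormedSpace ℝ B] [CompleteSpace B] (j : B ≃ₗ[ℝ] E) (hj : Continuous (i ∘ j)) :
    TopologicalSpace.SeparableSpace B := by
  have := hE.uniformAddGroup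
  have := hE.metrizable
  have := hE.continuousSMul
  have := hE.separable
  have := hE.baireSpace
  -- The graph of the inverse is an equalizer of two continuous maps into the Hausdorff space `G`.
  have hcl : IsClosed {p : E × B | j.symm.toLinearMap p.1 = p.2} := by
    have : {p : E × B | j.symm.toLinearMap p.1 = p.2} = {p : E × B | i p.1 = (i ∘ j) p.2} := by
      ext p
      exact j.symm_apply_eq.trans hi'.eq_iff.symm
    rw [this]
    exact isClosed_eq (hi.comp continuous_fst) (hj.comp continuous_snd)
  have hc := LinearMap.continuous_of_isClosed_graph_of_baireSpace _ hcl
  exact j.symm.surjective.denseRange.separableSpace hc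

theorem IsPolishable.separableSpace_of_linearEquiv {E B : Type*} [AddCommGroup E] [Module ℝ E]
    [τ : TopologicalSpace E] [hτ : T2Space E] (hE : IsPolishable E) [NormedAddCommGroup B]
    [NormedSpace ℝ B] [CompleteSpace B] (j : B ≃ₗ[ℝ] E) (hj : Continuous j) :
    TopologicalSpace.SeparableSpace B := by
  obtain ⟨u, hu, h⟩ := hE
  exact @IsSeparableFrechet.separableSpace_of_linearEquiv E B E _ _ u h τ hτ id
    (continuous_id_of_le hu) Function.injective_id _ _ _ j hj

open BoundedContinuousFunction in
theorem hasJNP_of_isPolishable_quotient {X : Type*} [TopologicalSpace X]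
    (hX : ∀ f : X → ℝ, Continuous f → ∃ M : ℝ, ∀ x, |f x| ≤ M) {Z : Submodule ℝ (Cp X)}
    (hZ : IsClosed (Z : Set (Cp X))) (hinf : ¬ FiniteDimensional ℝ (Cp X ⧸ Z))
    (hpol : IsPolishable (Cp X ⧸ Z)) : HasJNP X := by
  let ι : (X →ᵇ ℝ) →ₗ[ℝ] Cp X :=
    { toFun := fun f => ⟨f, f.continuous⟩
      map_add' := fun f g => rfl
      map_smul' := fun c f => rfl }
  have hι : Continuous ι := by
    refine Continuous.subtype_mk (continuous_pi fun x => ?_) _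
    exact continuous_eval_const x
  have hιs : Function.Surjective ι := by
    intro f
    obtain ⟨M, hM⟩ := hX f f.2
    exact ⟨BoundedContinuousFunction.ofNormedAddCommGroup f f.2 M hM, rfl⟩
  let K : Submodule ℝ (X →ᵇ ℝ) := Z.comap ι
  have hK : IsClosed (K : Set (X →ᵇ ℝ)) := hZ.preimage hι
  have : IsClosed (Z.toAddSubgroup : Set (Cp X)) := hZ
  have : IsClosed (K.toAddSubgroup : Set (X →ᵇ ℝ)) := hK
  have : T3Space (Cp X ⧸ Z) := Submodule.t3_quotient_of_isClosed Z
  let j₀ : ((X →ᵇ ℝ) ⧸ K) →ₗ[ℝ] (Cp X ⧸ Z) := K.mapQ Z ι le_rfl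
  have hj₀ : Function.Bijective j₀ := by
    constructor
    · rw [← LinearMap.ker_eq_bot, Submodule.ker_mapQ]
      exact Submodule.mkQ_map_self _
    · intro q
      obtain ⟨f, rfl⟩ := Submodule.mkQ_surjective _ q
      obtain ⟨b, rfl⟩ := hιs f
      exact ⟨Submodule.Quotient.mk b, rfl⟩
  have hj₀c : Continuous j₀ := by
    refine continuous_quot_lift _ ?_
    exact continuous_quot_mk.comp hι
  have hsep := hpol.separableSpace_of_linearEquiv (B := (X →ᵇ ℝ) ⧸ K)
    (LinearEquiv.ofBijective j₀ hj₀) hj₀c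
  obtain ⟨q, hq⟩ := TopologicalSpace.exists_dense_seq ((X →ᵇ ℝ) ⧸ K)
  choose b hb using fun n => Submodule.mkQ_surjective K (q n)
  have hμ : ∀ n : ℕ, ∃ μ : X →₀ ℝ, signMeasureNorm μ = 1 ∧
      (∀ f ∈ Z, signMeasureEval μ f = 0) ∧ ∀ k ≤ n, signMeasureEval μ (b k) = 0 := by
    intro n
    let S : Submodule ℝ (Cp X) := Submodule.span ℝ ((fun k => ι (b k)) '' Set.Iic n)
    have hS : FiniteDimensional ℝ S :=
      FiniteDimensional.span_of_finite ℝ ((Set.finite_Iic n).image _)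
    have hcl := Submodule.isClosed_sup_finiteDimensional Z S hZ
    -- Otherwise the finite-dimensional `S` would map onto the quotient.
    have hne : Z ⊔ S ≠ ⊤ := by
      intro htop
      apply hinf
      have : S.map Z.mkQ = ⊤ := by
        rw [← Submodule.comap_injective_of_surjective (Submodule.mkQ_surjective Z) |>.eq_iff]
        simpa [Submodule.comap_map_mkQ] using htop
      have h2 : FiniteDimensional ℝ (S.map Z.mkQ) := inferInstance
      rw [this] at h2
      exact Module.Finite.equiv (Submodule.topEquiv)
    obtain ⟨μ, h1, h2⟩ := exists_signMeasure_of_isClosed hcl hne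
    exact ⟨μ, h1, fun f hf => h2 f (Submodule.mem_sup_left hf),
      fun k hk => h2 (ι (b k)) (Submodule.mem_sup_right (Submodule.subset_span ⟨k, hk, rfl⟩))⟩
  choose μ hμ1 hμZ hμb using hμ
  refine ⟨μ, hμ1, fun f => ?_⟩
  obtain ⟨f, rfl⟩ := hιs f
  rw [Metric.tendsto_atTop]
  intro ε hε
  obtain ⟨k, hk⟩ := hq.exists_dist_lt (K.mkQ f) (show 0 < ε / 2 by positivity)
  rw [← hb, dist_eq_norm, ← map_sub] at hk
  -- Modulo `K`, `f` is `b k` plus a function `m` of norm below `ε`; for `n ≥ k` the measure `μ n`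
  -- sees only `m`.
  obtain ⟨m, hm, hm'⟩ := Submodule.Quotient.norm_mk_lt (K.mkQ (f - b k))
    (show 0 < ε / 2 by positivity)
  have hmK : f - b k - m ∈ K := (Submodule.Quotient.eq K).1 hm.symm
  refine ⟨k, fun n hn => ?_⟩
  have h1 : signMeasureCLM (μ n) (ι (f - b k - m)) = 0 := hμZ n _ hmK
  have h2 : signMeasureCLM (μ n) (ι (b k)) = 0 := hμb n k hn
  rw [map_sub, map_sub, map_sub, map_sub, h2, sub_zero, sub_eq_zero] at h1
  rw [Real.dist_eq, sub_zero, ← signMeasureCLM_apply, h1, signMeasureCLM_apply]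
  have h3 := abs_signMeasureEval_le (μ n) (f := ι m) (C := ‖m‖) (fun x => m.norm_coe_le_norm x)
  rw [hμ1, mul_one] at h3
  linarith

/-! ### Polishability of `ℝ^ℕ` and of `c₀` -/

theorem IsSeparableFrechet.of_isUniformInducing {E F : Type*} [AddCommGroup E] [Module ℝ E]
    [u : UniformSpace E] [AddCommGroup F] [Module ℝ F] [v : UniformSpace F]
    (hE : IsSeparableFrechet E) (e : F ≃ₗ[ℝ] E) (he : IsUniformInducing e) :
    IsSeparableFrechet F := by
  have := hE.uniformAddGroup
  have := hE.continuousSMul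
  have := hE.locallyConvex
  have := hE.metrizable
  have := hE.complete
  have := hE.separable
  let U : F ≃ᵤ E := e.toEquiv.toUniformEquivOfIsUniformInducing he
  exact
    { uniformAddGroup := he.comap_uniformSpace ▸ IsUniformAddGroup.comap e
      continuousSMul := he.isInducing.continuousSMul continuous_id (map_smul e _ _)
      locallyConvex := Topology.IsInducing.locallyConvexSpace (f := e.toLinearMap) he.isInducing
      metrizable := U.toHomeomorph.isEmbedding.metrizableSpace
      complete := U.completeSpace_iff.2 inferInstance
      separable := U.symm.surjective.denseRange.separableSpace U.symm.continuous }

/-- One direction of continuity suffices: the Fréchet topology carried over along `e` stays finer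
than that of `F`. -/
theorem IsPolishable.of_linearEquiv {E F : Type*} [AddCommGroup E] [Module ℝ E]
    [TopologicalSpace E] [AddCommGroup F] [Module ℝ F] [τ : TopologicalSpace F]
    (hE : IsPolishable E) (e : E ≃ₗ[ℝ] F) (he : Continuous e) : IsPolishable F := by
  have key : ∀ s, IsOpen s → IsOpen (e ⁻¹' s) := fun s hs => hs.preimage he
  obtain ⟨u, hu, h⟩ := hE
  refine ⟨u.comap e.symm, ?_, @IsSeparableFrechet.of_isUniformInducing E F _ _ u _ _
    (u.comap e.symm) h e.symm (@IsUniformInducing.mk _ _ (u.comap e.symm) u _ rfl)⟩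
  intro s hs
  rw [UniformSpace.toTopologicalSpace_comap]
  refine (@isOpen_induced_iff _ _ u.toTopologicalSpace _ _).2 ⟨e ⁻¹' s, hu _ (key s hs), ?_⟩
  ext x
  simp

theorem IsSeparableFrechet.isPolishable {E : Type*} [AddCommGroup E] [Module ℝ E]
    [u : UniformSpace E] (hE : IsSeparableFrechet E) : IsPolishable E :=
  ⟨u, le_rfl, hE⟩

theorem isPolishable_pi_nat : IsPolishable (ℕ → ℝ) :=
  IsSeparableFrechet.isPolishable
    { uniformAddGroup := inferInstance
      continuousSMul := inferInstance
      locallyConvex := inferInstance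
      metrizable := inferInstance
      complete := inferInstance
      separable := inferInstance }

open scoped ZeroAtInfty in
/-- The linear bijection from the Banach space of sequences tending to zero to `cZero`. -/
noncomputable def zeroAtInftyEquivCZero : C₀(ℕ, ℝ) ≃ₗ[ℝ] cZero where
  toFun f := ⟨f, by
    have := f.zero_at_infty'
    rwa [cocompact_eq_cofinite, Nat.cofinite_eq_atTop] at this⟩
  map_add' f g := rfl
  map_smul' c f := rfl
  invFun x := ⟨⟨x, continuous_of_discreteTopology⟩, by
    rw [cocompact_eq_cofinite, Nat.cofinite_eq_atTop]
    exact x.2⟩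
  left_inv f := rfl
  right_inv x := rfl

open scoped ZeroAtInfty in
theorem zeroAtInfty_nat_separableSpace : TopologicalSpace.SeparableSpace C₀(ℕ, ℝ) := by
  let e : ℕ → C₀(ℕ, ℝ) := fun n => zeroAtInftyEquivCZero.symm
    ⟨Pi.single n 1, tendsto_const_nhds.congr' (by
      filter_upwards [eventually_gt_atTop n] with k hk
      simp [hk.ne'])⟩
  have he : ∀ n k, e n k = if k = n then 1 else 0 := fun n k => by
    change (Pi.single n 1 : ℕ → ℝ) k = _
    rw [Pi.single_apply]
  have hs : TopologicalSpace.IsSeparable (closure (Submodule.span ℝ (Set.range e) : Set C₀(ℕ, ℝ))) :=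
    ((Set.countable_range e).isSeparable.span ).closure
  have huniv : closure (Submodule.span ℝ (Set.range e) : Set C₀(ℕ, ℝ)) = Set.univ := by
    refine Set.eq_univ_of_forall fun f => Metric.mem_closure_iff.2 fun ε hε => ?_
    have hf : Tendsto f atTop (𝓝 0) := (zeroAtInftyEquivCZero f).2
    obtain ⟨N, hN⟩ := Metric.tendsto_atTop.1 hf (ε / 2) (by positivity)
    -- Truncations of `f` approximate it uniformly since its tail is small.
    refine ⟨∑ n ∈ Finset.range N, f n • e n,
      Submodule.sum_mem _ fun n _ => Submodule.smul_mem _ _ (Submodule.subset_span ⟨n, rfl⟩), ?_⟩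
    refine lt_of_le_of_lt ?_ (half_lt_self hε)
    rw [← ZeroAtInftyContinuousMap.dist_toBCF_eq_dist, BoundedContinuousFunction.dist_le (by positivity)]
    intro k
    have hk : (∑ n ∈ Finset.range N, f n • e n) k = if k < N then f k else 0 := by
      have : (∑ n ∈ Finset.range N, f n • e n) k = ∑ n ∈ Finset.range N, f n * e n k := by
        clear hN
        induction N with
        | zero => rfl
        | succ N ih =>
          rw [Finset.sum_range_succ, Finset.sum_range_succ, ← ih]
          rfl
      rw [this]
      simp [he]
    change dist (f k) ((∑ n ∈ Finset.range N, f n • e n) k) ≤ ε / 2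
    rw [hk]
    split_ifs with h
    · simp; positivity
    · exact (hN k (not_lt.1 h)).le
  rw [huniv] at hs
  exact TopologicalSpace.isSeparable_univ_iff.1 hs

open scoped ZeroAtInfty in
theorem isPolishable_cZero : IsPolishable cZero := by
  have : IsPolishable C₀(ℕ, ℝ) := IsSeparableFrechet.isPolishable
    { uniformAddGroup := inferInstance
      continuousSMul := inferInstance
      locallyConvex := inferInstance
      metrizable := inferInstance
      complete := inferInstance
      separable := zeroAtInfty_nat_separableSpace }
  refine this.of_linearEquiv zeroAtInftyEquivCZero (Continuous.subtype_mk ?_ _)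
  exact continuous_pi fun n =>
    (BoundedContinuousFunction.evalCLM ℝ n).continuous.comp
      ZeroAtInftyContinuousMap.isometry_toBCF.continuous

theorem not_finiteDimensional_cZero : ¬ FiniteDimensional ℝ cZero := by
  intro h
  let φ : (ℕ →₀ ℝ) →ₗ[ℝ] cZero := LinearMap.codRestrict cZero Finsupp.lcoeFun fun f =>
    tendsto_const_nhds.congr' (by
      have := f.support.finite_toSet.eventually_cofinite_notMem
      rw [Nat.cofinite_eq_atTop] at this
      filter_upwards [this] with k hk
      simpa [eq_comm] using hk)
  have hφ : Function.Injective φ := fun f g hfg => by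
    ext n
    exact congrFun (congrArg Subtype.val hfg) n
  have h2 := Module.Finite.of_injective φ hφ
  have := Module.finite_finsupp_self_iff.1 h2
  exact this.elim (fun h => not_subsingleton ℝ h) (fun h => not_finite ℕ)

theorem not_finiteDimensional_pi_nat : ¬ FiniteDimensional ℝ (ℕ → ℝ) := fun _ =>
  not_finiteDimensional_cZero inferInstance

/-! ### Complemented subspaces and biorthogonal systems -/

/-- The quotient by the kernel of the projection receives a continuous linear bijection from `S`. -/
theorem exists_polishable_quotient {E : Type*} [AddCommGroup E] [Module ℝ E] [TopologicalSpace E]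
    [T2Space E] {S : Submodule ℝ E} (hS : S.ClosedComplemented) (hfin : ¬ FiniteDimensional ℝ S)
    (hpol : IsPolishable S) :
    ∃ Z : Submodule ℝ E, IsClosed (Z : Set E) ∧
        ¬ FiniteDimensional ℝ (E ⧸ Z) ∧ IsPolishable (E ⧸ Z) := by
  obtain ⟨f, hf⟩ := hS
  have hc : IsCompl S f.ker := LinearMap.isCompl_of_proj hf
  let e : S ≃ₗ[ℝ] (E ⧸ f.ker) := (Submodule.quotientEquivOfIsCompl _ _ hc.symm).symm
  refine ⟨f.ker, f.isClosed_ker, fun h => hfin (Module.Finite.equiv e.symm),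
    hpol.of_linearEquiv e ?_⟩
  exact continuous_quot_mk.comp continuous_subtype_val

theorem ContinuousLinearMap.exists_closedComplemented_equiv {E F : Type*} [AddCommGroup E]
    [Module ℝ E] [TopologicalSpace E] [AddCommGroup F] [Module ℝ F] [TopologicalSpace F]
    [IsTopologicalAddGroup F] (T : E →L[ℝ] F) (R : F →L[ℝ] E) (h : Function.LeftInverse R T) :
    ∃ S : Submodule ℝ F, S.ClosedComplemented ∧ Nonempty (S ≃L[ℝ] E) := by
  refine ⟨T.range, T.closedComplemented_range_of_leftInverse R h,
    ⟨ContinuousLinearEquiv.equivOfInverse (R.comp T.range.subtypeL)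
      (T.codRestrict T.range fun x => LinearMap.mem_range_self _ x) ?_ fun x => h x⟩⟩
  rintro ⟨_, x, rfl⟩
  exact Subtype.ext (congrArg T (h x))

/-- The index `N` replaces the series `∑ t n * φ n x` by its only possibly nonzero term. -/
theorem exists_index_of_disjoint {X : Type*} {φ : ℕ → X → ℝ}
    (hφ : ∀ x m n, φ m x ≠ 0 → φ n x ≠ 0 → m = n) (x : X) :
    ∃ N, ∀ n, n ≠ N → φ n x = 0 := by
  by_cases h : ∃ n, φ n x ≠ 0
  · obtain ⟨N, hN⟩ := h
    exact ⟨N, fun n hn => by_contra fun h => hn (hφ x n N h hN)⟩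
  · push Not at h
    exact ⟨0, fun n _ => h n⟩

theorem sum_mul_eq_of_disjoint {X : Type*} {φ : ℕ → X → ℝ} {N : X → ℕ}
    (hN : ∀ x n, n ≠ N x → φ n x = 0) (t : ℕ → ℝ) {I : Finset ℕ} {x : X}
    (hI : ∀ n ∉ I, φ n x = 0) : ∑ n ∈ I, t n * φ n x = t (N x) * φ (N x) x := by
  refine Finset.sum_eq_single (N x) (fun n _ hn => by rw [hN x n hn, mul_zero]) fun h => ?_
  rw [hI _ h, mul_zero]

/-- If `φ` is a sequence of disjointly supported continuous functions on `X`, with a biorthogonal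
sequence `ν` of finitely supported sign-measures, then a space `E` of sequences is isomorphic to a
complemented subspace of `Cp X` as soon as the sums `∑ n, t n * φ n` with `t ∈ E` are
continuous and the sequences `ν n f` with `f ∈ Cp X` belong to `E`. -/
theorem exists_closedComplemented_equiv_of_biorthogonal {X : Type*} [TopologicalSpace X]
    (E : Submodule ℝ (ℕ → ℝ)) {φ : ℕ → X → ℝ} {N : X → ℕ}
    (hN : ∀ x n, n ≠ N x → φ n x = 0)
    (hE : ∀ t ∈ E, Continuous fun x => t (N x) * φ (N x) x) {ν : ℕ → X →₀ ℝ}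
    (hν : ∀ f : Cp X, (fun n => signMeasureEval (ν n) f) ∈ E)
    (hνφ : ∀ k j, signMeasureEval (ν k) (φ j) = if k = j then 1 else 0) :
    ∃ S : Submodule ℝ (Cp X), S.ClosedComplemented ∧ Nonempty (S ≃L[ℝ] E) := by
  let T : E →L[ℝ] Cp X :=
    { toFun := fun t => ⟨fun x => (t : ℕ → ℝ) (N x) * φ (N x) x, hE t t.2⟩
      map_add' := fun s t => Subtype.ext <| funext fun x => by simp [add_mul]
      map_smul' := fun c t => Subtype.ext <| funext fun x => by simp [mul_assoc]
      cont := Continuous.subtype_mk (continuous_pi fun x =>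
        ((continuous_apply (N x)).comp continuous_subtype_val).mul continuous_const) _ }
  let R : Cp X →L[ℝ] E := (ContinuousLinearMap.pi fun n => signMeasureCLM (ν n)).codRestrict E hν
  refine T.exists_closedComplemented_equiv R fun t => Subtype.ext <| funext fun k => ?_
  change signMeasureEval (ν k) (fun x => (t : ℕ → ℝ) (N x) * φ (N x) x) = (t : ℕ → ℝ) k
  -- On the support of `ν k` only the indices `N x` matter, so a finite sum is enough; `k` is added
  -- so that the diagonal term is present.
  set I : Finset ℕ := insert k ((ν k).support.image N) with hI
  have h1 : signMeasureEval (ν k) (fun x => (t : ℕ → ℝ) (N x) * φ (N x) x) =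
      ∑ j ∈ I, (t : ℕ → ℝ) j * signMeasureEval (ν k) (φ j) := by
    simp only [signMeasureEval_eq_sum, Finset.mul_sum]
    rw [Finset.sum_comm]
    refine Finset.sum_congr rfl fun x hx => ?_
    rw [← sum_mul_eq_of_disjoint hN (t : ℕ → ℝ) (I := I), Finset.mul_sum]
    · exact Finset.sum_congr rfl fun j _ => by ring
    · intro n hn
      refine hN x n fun h => hn ?_
      rw [hI, h]
      exact Finset.mem_insert_of_mem (Finset.mem_image_of_mem N hx)
  rw [h1]
  simp [hνφ, hI]

/-! ### Unbounded functions and `ℝ^ℕ` -/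

/-- Tents of radius 1 in the values of `|f|`, centred at values more than 2 apart and tending to
infinity, form a locally finite disjoint family, so every sequence of coefficients gives a
continuous sum. -/
theorem exists_complemented_pi_nat {X : Type*} [TopologicalSpace X] {f : X → ℝ}
    (hf : Continuous f) (hf' : ∀ M : ℝ, ∃ x, M < |f x|) :
    ∃ S : Submodule ℝ (Cp X), S.ClosedComplemented ∧ Nonempty (S ≃L[ℝ] (ℕ → ℝ)) := by
  choose p hp using hf'
  let z : ℕ → X := fun n => Nat.rec (p 0) (fun _ y => p (|f y| + 2)) n
  set g : X → ℝ := fun x => |f x| with hg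
  have hgc : Continuous g := hf.abs
  have hz1 : ∀ n, g (z n) + 2 < g (z (n + 1)) := fun n => hp _
  have hzlt : ∀ m n, m < n → g (z m) + 2 < g (z n) := by
    intro m n hmn
    induction n, hmn using Nat.le_induction with
    | base => exact hz1 m
    | succ n _ ih => linarith [hz1 n]
  have hzn : ∀ n : ℕ, (n : ℝ) ≤ g (z n) := by
    intro n
    induction n with
    | zero => simp [hg]
    | succ n ih => push_cast; linarith [hz1 n]
  let φ : ℕ → X → ℝ := fun n x => max 0 (1 - |g x - g (z n)|)
  have hφc : ∀ n, Continuous (φ n) := fun n =>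
    continuous_const.max (continuous_const.sub (hgc.sub continuous_const).abs)
  have hφ0 : ∀ n x, φ n x ≠ 0 → |g x - g (z n)| < 1 := by
    intro n x h
    by_contra! h'
    exact h (max_eq_left (by linarith))
  have hdisj : ∀ x m n, φ m x ≠ 0 → φ n x ≠ 0 → m = n := by
    have : ∀ x m n, φ m x ≠ 0 → φ n x ≠ 0 → ¬ m < n := by
      intro x m n hm hn hmn
      have h1 := abs_lt.1 (hφ0 m x hm)
      have h2 := abs_lt.1 (hφ0 n x hn)
      linarith [hzlt m n hmn]
    intro x m n hm hn
    exact le_antisymm (not_lt.1 (this x n m hn hm)) (not_lt.1 (this x m n hm hn))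
  choose N hN using exists_index_of_disjoint hdisj
  have hφz : ∀ k j, φ j (z k) = if k = j then 1 else 0 := by
    intro k j
    have hk : φ k (z k) = 1 := by simp [φ]
    split_ifs with h
    · rw [← h, hk]
    · by_contra h'
      exact h (hdisj (z k) k j (by rw [hk]; exact one_ne_zero) h')
  obtain ⟨S, hS, ⟨e⟩⟩ := exists_closedComplemented_equiv_of_biorthogonal ⊤ hN
    (fun t _ => by
      refine continuous_iff_continuousAt.2 fun x => ?_
      -- A tent with `n ≥ M` vanishes where `g < g x + 1`: one unit of the margin is its radius, the
      -- other the variation of `g` near `x`.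
      obtain ⟨M, hM⟩ := exists_nat_gt (g x + 2)
      have hnear : ∀ᶠ y in 𝓝 x, g y < g x + 1 :=
        hgc.continuousAt.eventually (gt_mem_nhds (by linarith))
      have hsum : ContinuousAt (fun y => ∑ n ∈ Finset.range M, t n * φ n y) x :=
        (continuous_finsetSum _ fun n _ => continuous_const.mul (hφc n)).continuousAt
      refine hsum.congr ?_
      filter_upwards [hnear] with y hy
      refine sum_mul_eq_of_disjoint hN t fun n hn => ?_
      by_contra h
      have h1 := abs_lt.1 (hφ0 n y h)
      have h2 : (M : ℝ) ≤ n := by simpa using hn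
      linarith [hzn n])
    (ν := fun k => Finsupp.single (z k) 1) (fun f => trivial)
    (fun k j => by simp [signMeasureEval, hφz])
  refine ⟨S, hS, ⟨e.trans (ContinuousLinearEquiv.equivOfInverse (⊤ : Submodule ℝ (ℕ → ℝ)).subtypeL
    ((ContinuousLinearMap.id ℝ (ℕ → ℝ)).codRestrict ⊤ fun _ => trivial)
    (fun x => rfl) (fun x => rfl))⟩⟩

/-! ### Triangular systems and `c₀` -/

/-- The rows of `a` sum to at most 1/2, so `s` is bounded by twice the bound of `y`. Dominated
convergence, with the columns tending to zero, then makes the correction terms vanish in the limit.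
-/
theorem tendsto_zero_of_triangular_recursion {s y b : ℕ → ℝ} {a : ℕ → ℕ → ℝ}
    (hs : ∀ k, s k = y k - ∑ j ∈ Finset.range k, a k j * s j) (hy : Tendsto y atTop (𝓝 0))
    (ha : ∀ j, Tendsto (fun k => a k j) atTop (𝓝 0)) (hab : ∀ k j, j < k → |a k j| ≤ b j)
    (hb : Summable b) (hb' : ∑' j, b j ≤ 1 / 2) : Tendsto s atTop (𝓝 0) := by
  have hb0 : ∀ j, 0 ≤ b j := fun j => (abs_nonneg _).trans (hab (j + 1) j j.lt_succ_self)
  obtain ⟨Y, hY⟩ : ∃ Y, ∀ n, |y n| ≤ Y := by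
    obtain ⟨Y, hY⟩ := (Metric.isBounded_range_of_tendsto y hy).exists_norm_le
    exact ⟨Y, fun n => hY _ ⟨n, rfl⟩⟩
  have hY0 : 0 ≤ Y := (abs_nonneg _).trans (hY 0)
  have hsY : ∀ k, |s k| ≤ 2 * Y := by
    intro k
    induction k using Nat.strong_induction_on with
    | _ k ih =>
      have h1 : |∑ j ∈ Finset.range k, a k j * s j| ≤ ∑ j ∈ Finset.range k, b j * (2 * Y) := by
        refine (Finset.abs_sum_le_sum_abs _ _).trans (Finset.sum_le_sum fun j hj => ?_)
        rw [abs_mul]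
        have hj' := Finset.mem_range.1 hj
        exact mul_le_mul (hab k j hj') (ih j hj') (abs_nonneg _) (hb0 j)
      rw [← Finset.sum_mul] at h1
      have h2 : ∑ j ∈ Finset.range k, b j ≤ 1 / 2 :=
        (hb.sum_le_tsum _ fun j _ => hb0 j).trans hb'
      have h3 : (∑ j ∈ Finset.range k, b j) * (2 * Y) ≤ 1 / 2 * (2 * Y) :=
        mul_le_mul_of_nonneg_right h2 (by positivity)
      rw [hs k]
      have := abs_sub (y k) (∑ j ∈ Finset.range k, a k j * s j)
      linarith [hY k]
  have hT := tendsto_tsum_of_dominated_convergence (𝓕 := atTop)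
    (f := fun k j => if j < k then a k j * s j else 0) (g := fun _ => 0)
    (bound := fun j => b j * (2 * Y)) (hb.mul_right _)
    (fun j => by
      have : Tendsto (fun k => a k j * s j) atTop (𝓝 0) := by simpa using (ha j).mul_const (s j)
      refine this.congr' ?_
      filter_upwards [eventually_gt_atTop j] with k hk
      rw [if_pos hk])
    (Eventually.of_forall fun k j => by
      split_ifs with h
      · rw [Real.norm_eq_abs, abs_mul]
        exact mul_le_mul (hab k j h) (hsY j) (abs_nonneg _) (hb0 j)
      · rw [norm_zero]
        have := hb0 j
        positivity)
  rw [tsum_zero] at hT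
  have h4 : s = fun k => y k - ∑' j, if j < k then a k j * s j else 0 := by
    funext k
    rw [tsum_eq_sum (s := Finset.range k) fun j hj => if_neg (by simpa using hj)]
    conv_lhs => rw [hs k]
    congr 1
    exact Finset.sum_congr rfl fun j hj => (if_pos (Finset.mem_range.1 hj)).symm
  rw [h4]
  simpa using hy.sub hT

/-- Gram–Schmidt style modification of a sequence of sign-measures by a lower triangular matrix. -/
noncomputable def triangularCorrection {X : Type*} (lam : ℕ → X →₀ ℝ) (a : ℕ → ℕ → ℝ) :
    ℕ → X →₀ ℝ
  | k => lam k - ∑ j : Fin k, a k j • triangularCorrection lam a j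
decreasing_by exact j.2

theorem signMeasureEval_triangularCorrection {X : Type*} (lam : ℕ → X →₀ ℝ) (a : ℕ → ℕ → ℝ)
    (k : ℕ) (f : X → ℝ) :
    signMeasureEval (triangularCorrection lam a k) f = signMeasureEval (lam k) f -
      ∑ j ∈ Finset.range k, a k j * signMeasureEval (triangularCorrection lam a j) f := by
  rw [triangularCorrection, Finset.sum_range]
  simp [signMeasureEval_eq_linearCombination]

/-- Subtracting earlier corrected measures turns a lower unitriangular matrix into the identity; the
summable bound on its entries keeps the corrected measures null on `Cp X`. -/
theorem exists_complemented_cZero_of_triangular {X : Type*} [TopologicalSpace X]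
    {φ : ℕ → X → ℝ} (hφc : ∀ n, Continuous (φ n)) {C : ℝ} (hφb : ∀ n x, |φ n x| ≤ C)
    (hφd : ∀ x m n, φ m x ≠ 0 → φ n x ≠ 0 → m = n) {lam : ℕ → X →₀ ℝ}
    (hlam : ∀ f : Cp X, Tendsto (fun n => signMeasureEval (lam n) f) atTop (𝓝 0))
    (hdiag : ∀ k, signMeasureEval (lam k) (φ k) = 1)
    (hupper : ∀ k j, k < j → signMeasureEval (lam k) (φ j) = 0) {b : ℕ → ℝ}
    (hlower : ∀ k j, j < k → |signMeasureEval (lam k) (φ j)| ≤ b j)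
    (hb : Summable b) (hb' : ∑' j, b j ≤ 1 / 2) :
    ∃ S : Submodule ℝ (Cp X), S.ClosedComplemented ∧ Nonempty (S ≃L[ℝ] cZero) := by
  choose N hN using exists_index_of_disjoint hφd
  set a : ℕ → ℕ → ℝ := fun k j => signMeasureEval (lam k) (φ j) with ha
  refine exists_closedComplemented_equiv_of_biorthogonal cZero hN ?_
    (ν := triangularCorrection lam a) ?_ ?_
  · intro t ht
    have ht' : Tendsto (fun n => |t n| * C) atTop (𝓝 0) := by
      simpa using (show Tendsto t atTop (𝓝 0) from ht).abs.mul_const C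
    -- As `t` tends to zero and the `φ n` are disjoint and uniformly bounded, partial sums converge
    -- uniformly.
    refine continuous_of_uniform_approx_of_continuous fun u hu => ?_
    obtain ⟨ε, hε, hεu⟩ := Metric.mem_uniformity_dist.1 hu
    obtain ⟨M, hM⟩ := eventually_atTop.1 (ht'.eventually (gt_mem_nhds hε))
    refine ⟨fun x => ∑ n ∈ Finset.range M, t n * φ n x,
      continuous_finsetSum _ fun n _ => continuous_const.mul (hφc n), fun x => hεu ?_⟩
    beta_reduce
    by_cases h : N x < M
    · rw [sum_mul_eq_of_disjoint hN t fun n hn => hN x n ?_]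
      · simpa using hε
      · rintro rfl
        exact hn (Finset.mem_range.2 h)
    · rw [Finset.sum_eq_zero fun n hn => ?_, dist_zero_right, norm_mul]
      · exact (mul_le_mul_of_nonneg_left (hφb _ x) (abs_nonneg _)).trans_lt (hM _ (not_lt.1 h))
      · rw [hN x n fun h' => h (h' ▸ Finset.mem_range.1 hn), mul_zero]
  · intro f
    exact tendsto_zero_of_triangular_recursion
      (fun k => signMeasureEval_triangularCorrection lam a k f) (hlam f)
      (fun j => hlam ⟨φ j, hφc j⟩) hlower hb hb'
  · intro k j
    induction k using Nat.strong_induction_on with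
    | _ k ih =>
      rw [signMeasureEval_triangularCorrection,
        Finset.sum_congr rfl fun i hi => by rw [ih i (Finset.mem_range.1 hi)]]
      simp only [mul_ite, mul_one, mul_zero, Finset.sum_ite_eq', Finset.mem_range]
      rcases lt_trichotomy k j with h | rfl | h
      · rw [if_neg h.not_gt, if_neg h.ne, hupper k j h, sub_zero]
      · simp [hdiag]
      · rw [if_pos h, if_neg h.ne', ha, sub_self]

/-! ### Test functions and variation of sign-measures -/

theorem exists_continuous_one_on_finset {X : Type*} [TopologicalSpace X] [CompletelyRegularSpace X]
    (D : Finset X) {V : Set X} (hV : IsOpen V) (hD : ↑D ⊆ V) :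
    ∃ g : X → ℝ, Continuous g ∧ (∀ x, 0 ≤ g x ∧ g x ≤ 1) ∧ (∀ x ∈ D, g x = 1) ∧
      ∀ x ∉ V, g x = 0 := by
  have h : ∀ x : D, ∃ f : X → unitInterval, Continuous f ∧ f x = 0 ∧ Set.EqOn f 1 Vᶜ := fun x =>
    CompletelyRegularSpace.completely_regular_isOpen (x : X) V hV (hD x.2)
  choose f hfc hf0 hf1 using h
  have hprod : ∀ x, 0 ≤ ∏ d, (f d x : ℝ) ∧ ∏ d, (f d x : ℝ) ≤ 1 := fun x =>
    ⟨Finset.prod_nonneg fun d _ => (f d x).2.1,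
      Finset.prod_le_one (fun d _ => (f d x).2.1) fun d _ => (f d x).2.2⟩
  refine ⟨fun x => 1 - ∏ d, (f d x : ℝ), ?_, fun x => ?_, fun x hx => ?_, fun x hx => ?_⟩
  · exact continuous_const.sub
      (continuous_finsetProd _ fun d _ => continuous_subtype_val.comp (hfc d))
  · have := hprod x
    constructor <;> linarith
  · beta_reduce
    rw [Finset.prod_eq_zero (Finset.mem_univ ⟨x, hx⟩) (by rw [hf0]; rfl), sub_zero]
  · beta_reduce
    rw [Finset.prod_eq_one fun d _ => by rw [hf1 d hx]; rfl, sub_self]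

/-- The function is a difference of two bumps, one for the positive and one for the remaining points
of `D`, each supported off the other finite set. -/
theorem exists_continuous_sign_on_finset {X : Type*} [TopologicalSpace X] [T35Space X]
    (D : Finset X) {V : Set X} (hV : IsOpen V) (hD : ↑D ⊆ V) (σ : X → ℝ) :
    ∃ f : X → ℝ, Continuous f ∧ (∀ x, |f x| ≤ 1) ∧ (∀ x ∈ D, σ x * f x = |σ x|) ∧
      ∀ x ∉ V, f x = 0 := by
  classical
  obtain ⟨g, hgc, hg, hg1, hg0⟩ := exists_continuous_one_on_finset (D.filter fun x => 0 < σ x)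
    (hV.sdiff (D.filter fun x => ¬ 0 < σ x).finite_toSet.isClosed) (by
      intro x hx
      simp only [Finset.coe_filter, Set.mem_ofPred_eq, Set.mem_sdiff] at hx ⊢
      exact ⟨hD hx.1, fun h => h.2 hx.2⟩)
  obtain ⟨h, hhc, hh, hh1, hh0⟩ := exists_continuous_one_on_finset (D.filter fun x => ¬ 0 < σ x)
    (hV.sdiff (D.filter fun x => 0 < σ x).finite_toSet.isClosed) (by
      intro x hx
      simp only [Finset.coe_filter, Set.mem_ofPred_eq, Set.mem_sdiff] at hx ⊢
      exact ⟨hD hx.1, fun h => hx.2 h.2⟩)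
  refine ⟨fun x => g x - h x, hgc.sub hhc, fun x => ?_, fun x hx => ?_, fun x hx => ?_⟩
  · have := hg x
    have := hh x
    rw [abs_le]
    constructor <;> linarith
  · beta_reduce
    by_cases hσ : 0 < σ x
    · rw [hg1 x (by simp [hx, hσ]), hh0 x (by simp [hx, hσ]), abs_of_pos hσ]
      ring
    · rw [hg0 x (by simp [hx, not_lt.1 hσ]), hh1 x (by simp [hx, not_lt.1 hσ]),
        abs_of_nonpos (not_lt.1 hσ)]
      ring
  · beta_reduce
    rw [hg0 x fun h => hx h.1, hh0 x fun h => hx h.1, sub_zero]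

/-- The variation of the sign-measure `μ` on the set `U`. -/
noncomputable def signMeasureMass {X : Type*} (μ : X →₀ ℝ) (U : Set X) : ℝ :=
  ∑ x ∈ μ.support, U.indicator (fun x => |μ x|) x

theorem signMeasureMass_mono {X : Type*} (μ : X →₀ ℝ) {U V : Set X} (h : U ⊆ V) :
    signMeasureMass μ U ≤ signMeasureMass μ V :=
  Finset.sum_le_sum fun _ _ =>
    Set.indicator_le_indicator_of_subset h (fun _ => abs_nonneg _) _

theorem signMeasureMass_congr {X : Type*} (μ : X →₀ ℝ) {U V : Set X}
    (h : ∀ x ∈ μ.support, x ∈ U → x ∈ V) : signMeasureMass μ U ≤ signMeasureMass μ V := by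
  refine Finset.sum_le_sum fun x hx => ?_
  by_cases hU : x ∈ U
  · rw [Set.indicator_of_mem hU, Set.indicator_of_mem (h x hx hU)]
  · rw [Set.indicator_of_notMem hU]
    exact Set.indicator_nonneg (fun _ _ => abs_nonneg _) _

theorem signMeasureMass_union_le {X : Type*} (μ : X →₀ ℝ) (U V : Set X) :
    signMeasureMass μ (U ∪ V) ≤ signMeasureMass μ U + signMeasureMass μ V := by
  unfold signMeasureMass
  rw [← Finset.sum_add_distrib]
  refine Finset.sum_le_sum fun x _ => ?_
  have := abs_nonneg (μ x)
  by_cases hU : x ∈ U <;> by_cases hV : x ∈ V <;> simp [hU, hV]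

theorem signMeasureMass_biUnion_le {X ι : Type*} (μ : X →₀ ℝ) (I : Finset ι) (U : ι → Set X) :
    signMeasureMass μ (⋃ i ∈ I, U i) ≤ ∑ i ∈ I, signMeasureMass μ (U i) := by
  classical
  induction I using Finset.induction_on with
  | empty => simp [signMeasureMass]
  | insert i I hi ih =>
    rw [Finset.sum_insert hi, Finset.set_biUnion_insert]
    exact (signMeasureMass_union_le _ _ _).trans (add_le_add le_rfl ih)

theorem sum_signMeasureMass_le {X ι : Type*} (μ : X →₀ ℝ) (I : Finset ι) (U : ι → Set X)
    (hU : ∀ i ∈ I, ∀ j ∈ I, ∀ x ∈ U i, x ∈ U j → i = j) :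
    ∑ i ∈ I, signMeasureMass μ (U i) ≤ signMeasureNorm μ := by
  unfold signMeasureMass
  rw [Finset.sum_comm, signMeasureNorm_eq_sum]
  refine Finset.sum_le_sum fun x _ => ?_
  by_cases h : ∃ i ∈ I, x ∈ U i
  · obtain ⟨i, hi, hx⟩ := h
    rw [Finset.sum_eq_single_of_mem i hi fun j hj hji =>
      Set.indicator_of_notMem (fun h => hji (hU j hj i hi x h hx)) _]
    exact (Set.indicator_of_mem hx _).le
  · push Not at h
    rw [Finset.sum_eq_zero fun i hi => Set.indicator_of_notMem (h i hi) _]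
    exact abs_nonneg _

theorem signMeasureMass_finset_le {X : Type*} (μ : X →₀ ℝ) (F : Finset X) :
    signMeasureMass μ F ≤ ∑ x ∈ F, |μ x| := by
  classical
  unfold signMeasureMass
  simp only [Set.indicator_apply, Finset.mem_coe]
  rw [← Finset.sum_filter]
  exact Finset.sum_le_sum_of_subset_of_nonneg (fun x hx => (Finset.mem_filter.1 hx).2)
    fun _ _ _ => abs_nonneg _

theorem abs_signMeasureEval_le_mass {X : Type*} (μ : X →₀ ℝ) {f : X → ℝ} {C : ℝ} {U : Set X}
    (hf : ∀ x, |f x| ≤ C) (hU : ∀ x ∉ U, f x = 0) :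
    |signMeasureEval μ f| ≤ C * signMeasureMass μ U := by
  rw [signMeasureEval_eq_sum, signMeasureMass, Finset.mul_sum]
  refine (Finset.abs_sum_le_sum_abs _ _).trans (Finset.sum_le_sum fun x _ => ?_)
  by_cases hx : x ∈ U
  · rw [abs_mul, mul_comm, Set.indicator_of_mem hx]
    exact mul_le_mul_of_nonneg_right (hf x) (abs_nonneg _)
  · rw [hU x hx, Set.indicator_of_notMem hx, mul_zero, mul_zero, abs_zero]

/-- Each point off `D` costs at most twice its mass: its contribution to the norm is lost and may
reappear with the wrong sign. -/
theorem signMeasureNorm_sub_le_eval {X : Type*} (μ : X →₀ ℝ) {f : X → ℝ} {D : Set X}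
    (hf : ∀ x, |f x| ≤ 1) (hD : ∀ x ∈ D, μ x * f x = |μ x|) :
    signMeasureNorm μ - 2 * signMeasureMass μ Dᶜ ≤ signMeasureEval μ f := by
  rw [signMeasureEval_eq_sum, signMeasureMass, signMeasureNorm_eq_sum, Finset.mul_sum,
    ← Finset.sum_sub_distrib]
  refine Finset.sum_le_sum fun x _ => ?_
  by_cases hx : x ∈ D
  · rw [Set.indicator_of_notMem (show x ∉ Dᶜ from fun h => h hx), hD x hx]
    linarith
  · rw [Set.indicator_of_mem (show x ∈ Dᶜ from hx)]
    have h1 : |μ x * f x| ≤ |μ x| := by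
      rw [abs_mul]
      exact mul_le_of_le_one_right (abs_nonneg _) (hf x)
    linarith [neg_abs_le (μ x * f x)]

theorem abs_apply_le_signMeasureNorm {X : Type*} (μ : X →₀ ℝ) (x : X) :
    |μ x| ≤ signMeasureNorm μ := by
  rw [signMeasureNorm_eq_sum]
  by_cases hx : x ∈ μ.support
  · exact Finset.single_le_sum (f := fun x => |μ x|) (fun _ _ => abs_nonneg _) hx
  · rw [Finsupp.notMem_support_iff.1 hx, abs_zero]
    exact Finset.sum_nonneg fun _ _ => abs_nonneg _

/-! ### Gliding hump extractions -/

/-- All supports together are countable, so the coefficients live in a compact metrizable cube. -/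
theorem exists_pointwise_convergent_subseq {X : Type*} {μ : ℕ → X →₀ ℝ}
    (hμ : ∀ n, signMeasureNorm (μ n) ≤ 1) :
    ∃ ψ : ℕ → ℕ, StrictMono ψ ∧ ∀ x, ∃ l : ℝ, Tendsto (fun n => μ (ψ n) x) atTop (𝓝 l) := by
  let S : Set X := ⋃ n, (μ n).support
  have hS : S.Countable := Set.countable_iUnion fun n => (μ n).support.countable_toSet
  have : Countable S := hS.to_subtype
  have hc : IsCompact (Set.univ.pi fun _ : S => Set.Icc (-1 : ℝ) 1) :=
    isCompact_univ_pi fun _ => isCompact_Icc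
  obtain ⟨l, -, ψ, hψ, hl⟩ := hc.tendsto_subseq (x := fun n (x : S) => μ n x) fun n x _ =>
    abs_le.1 ((abs_apply_le_signMeasureNorm _ _).trans (hμ n))
  refine ⟨ψ, hψ, fun x => ?_⟩
  by_cases hx : x ∈ S
  · exact ⟨l ⟨x, hx⟩, tendsto_pi_nhds.1 hl ⟨x, hx⟩⟩
  · refine ⟨0, tendsto_const_nhds.congr fun n => ?_⟩
    by_contra h
    exact hx (Set.mem_iUnion.2 ⟨ψ n, Finsupp.mem_support_iff.2 (Ne.symm h)⟩)

/-- The sign-measures in the definition of the Josefson-Nissenzweig property can be chosen to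
converge to zero at all points. -/
theorem HasJNP.exists_pointwise_null {X : Type*} [TopologicalSpace X] [T35Space X]
    (h : HasJNP X) : ∃ lam : ℕ → X →₀ ℝ, (∀ n, signMeasureNorm (lam n) = 1) ∧
      (∀ f : Cp X, Tendsto (fun n => signMeasureEval (lam n) f) atTop (𝓝 0)) ∧
      ∀ x, Tendsto (fun n => lam n x) atTop (𝓝 0) := by
  obtain ⟨μ, hμ1, hμ0⟩ := h
  obtain ⟨ψ, hψ, hl⟩ := exists_pointwise_convergent_subseq fun n => (hμ1 n).le
  have hψ0 : ∀ f : Cp X, Tendsto (fun n => signMeasureEval (μ (ψ n)) f) atTop (𝓝 0) := fun f =>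
    (hμ0 f).comp hψ.tendsto_atTop
  -- Differences are null at points but might be small in norm. A test function on which `μ (ψ k)`
  -- is 1 and a late `μ (ψ m)` is below 1/2 prevents this.
  have hm : ∀ k, ∃ m, k < m ∧ 1 / 2 ≤ signMeasureNorm (μ (ψ k) - μ (ψ m)) := by
    intro k
    obtain ⟨f, hfc, hf1, hfs, -⟩ := exists_continuous_sign_on_finset (μ (ψ k)).support isOpen_univ
      (Set.subset_univ _) (μ (ψ k))
    have hk : signMeasureEval (μ (ψ k)) f = 1 := by
      rw [← hμ1 (ψ k), signMeasureEval_eq_sum, signMeasureNorm_eq_sum]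
      exact Finset.sum_congr rfl hfs
    obtain ⟨m, hm, hkm⟩ := (((hψ0 ⟨f, hfc⟩).eventually
      (gt_mem_nhds (show (0 : ℝ) < 1 / 2 by norm_num))).and (eventually_gt_atTop k)).exists
    refine ⟨m, hkm, ?_⟩
    have h1 := abs_signMeasureEval_le (μ (ψ k) - μ (ψ m)) hf1
    rw [signMeasureEval_sub, hk] at h1
    have h2 := le_abs_self (1 - signMeasureEval (μ (ψ m)) f)
    dsimp only at hm
    linarith
  choose m hkm hm using hm
  have hmt : Tendsto m atTop atTop := tendsto_atTop_mono (fun k => (hkm k).le) tendsto_id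
  let d : ℕ → X →₀ ℝ := fun k => μ (ψ k) - μ (ψ (m k))
  have hd0 : ∀ k, d k ≠ 0 := by
    intro k h0
    have := hm k
    change 1 / 2 ≤ signMeasureNorm (d k) at this
    rw [h0] at this
    norm_num [signMeasureNorm] at this
  have hc : ∀ k, |(signMeasureNorm (d k))⁻¹| ≤ 2 := by
    intro k
    rw [abs_of_pos (inv_pos.2 (signMeasureNorm_pos (hd0 k)))]
    exact inv_le_of_inv_le₀ two_pos (by simpa using hm k)
  have hnull : ∀ s : ℕ → ℝ, Tendsto s atTop (𝓝 0) →
      Tendsto (fun k => (signMeasureNorm (d k))⁻¹ * s k) atTop (𝓝 0) := fun s hs =>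
    bdd_le_mul_tendsto_zero' 2 (Eventually.of_forall hc) hs
  refine ⟨fun k => (signMeasureNorm (d k))⁻¹ • d k, fun k => signMeasureNorm_normalize (hd0 k),
    fun f => ?_, fun x => ?_⟩
  · simp only [signMeasureEval_smul]
    refine hnull _ ?_
    simp only [d, signMeasureEval_sub]
    simpa using (hψ0 f).sub ((hψ0 f).comp hmt)
  · simp only [Finsupp.smul_apply, smul_eq_mul]
    refine hnull _ ?_
    obtain ⟨l, hl⟩ := hl x
    simpa [d] using hl.sub (hl.comp hmt)

/-- A gliding hump: a sequence of sign-measures of norm one which converges to zero at all points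
has a subsequence whose members are almost concentrated off the supports of the previous ones. -/
theorem exists_subseq_mass_support_lt {X : Type*} {lam : ℕ → X →₀ ℝ}
    (hlam : ∀ x, Tendsto (fun n => lam n x) atTop (𝓝 0)) {δ : ℝ} (hδ : 0 < δ) :
    ∃ ψ : ℕ → ℕ, StrictMono ψ ∧
      ∀ k, signMeasureMass (lam (ψ k)) (⋃ j ∈ Finset.range k, ↑(lam (ψ j)).support) < δ := by
  classical
  -- All supports up to index `m` are collected, so each choice depends only on the last chosen
  -- index.
  let F : ℕ → Finset X := fun m => (Finset.range (m + 1)).biUnion fun i => (lam i).support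
  have h : ∀ m, ∃ g, m < g ∧ ∀ n, g ≤ n → signMeasureMass (lam n) (F m) < δ := by
    intro m
    have h1 : Tendsto (fun n => ∑ x ∈ F m, |lam n x|) atTop (𝓝 0) := by
      simpa using tendsto_finsetSum (F m) fun x _ => (hlam x).abs
    obtain ⟨g, hg⟩ := eventually_atTop.1 (h1.eventually (gt_mem_nhds hδ))
    exact ⟨max g (m + 1), by omega, fun n hn => (signMeasureMass_finset_le _ _).trans_lt
      (hg n (le_trans (le_max_left _ _) hn))⟩
  choose g hg hgm using h
  let ψ : ℕ → ℕ := fun k => Nat.rec 0 (fun _ m => g m) k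
  have hψ : StrictMono ψ := strictMono_nat_of_lt_succ fun k => hg _
  refine ⟨ψ, hψ, fun k => ?_⟩
  cases k with
  | zero => simpa [signMeasureMass] using hδ
  | succ k =>
    refine (signMeasureMass_mono _ ?_).trans_lt (hgm (ψ k) (ψ (k + 1)) le_rfl)
    intro x hx
    simp only [Set.mem_iUnion, Finset.mem_range, Finset.mem_coe] at hx
    obtain ⟨j, hj, hx⟩ := hx
    refine Finset.mem_coe.2 (Finset.mem_biUnion.2 ⟨ψ j, Finset.mem_range.2 ?_, hx⟩)
    have := hψ.monotone (Nat.lt_succ_iff.1 hj)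
    omega

/-- Finitely many points have disjoint neighbourhoods; regularity shrinks their unions so that the
closures remain disjoint. -/
theorem exists_isOpen_disjoint_closures {X : Type*} [TopologicalSpace X] [T3Space X]
    {D : ℕ → Finset X} (hD : ∀ i j, ∀ x ∈ D i, x ∈ D j → i = j) (I : Finset ℕ) :
    ∃ U : ℕ → Set X, (∀ i ∈ I, IsOpen (U i) ∧ ↑(D i) ⊆ U i) ∧
      ∀ i ∈ I, ∀ j ∈ I, ∀ x ∈ closure (U i), x ∈ closure (U j) → i = j := by
  classical
  obtain ⟨V, hV, hVd⟩ := (I.biUnion D).finite_toSet.t2_separation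
  have h : ∀ i, ∃ U : Set X, IsOpen U ∧ ↑(D i) ⊆ U ∧ closure U ⊆ ⋃ x ∈ D i, V x := by
    intro i
    refine (D i).finite_toSet.isCompact.exists_isOpen_closure_subset ?_
    refine (isOpen_biUnion fun x _ => (hV x).2).mem_nhdsSet.2 fun x hx => ?_
    exact Set.mem_biUnion (Finset.mem_coe.1 hx) (hV x).1
  choose U hUo hDU hU using h
  refine ⟨U, fun i _ => ⟨hUo i, hDU i⟩, fun i hi j hj y hyi hyj => ?_⟩
  obtain ⟨x, hx, hyx⟩ := Set.mem_iUnion₂.1 (hU i hyi)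
  obtain ⟨x', hx', hyx'⟩ := Set.mem_iUnion₂.1 (hU j hyj)
  have hxx : x = x' := by
    by_contra hne
    exact Set.disjoint_left.1 (hVd (Finset.mem_coe.2 (Finset.mem_biUnion.2 ⟨i, hi, hx⟩))
      (Finset.mem_coe.2 (Finset.mem_biUnion.2 ⟨j, hj, hx'⟩)) hne) hyx hyx'
  exact hD i j x hx (hxx ▸ hx')

/-- Among more than `1 / δ` sets with disjoint closures, every norm-one measure has mass below `δ`
on one of the closures; by pigeonhole one set serves infinitely many measures. -/
theorem exists_isOpen_infinite_mass_lt {X : Type*} [TopologicalSpace X] [T3Space X]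
    {lam : ℕ → X →₀ ℝ} (hlam : ∀ n, signMeasureNorm (lam n) = 1) {D : ℕ → Finset X}
    (hD : ∀ i j, ∀ x ∈ D i, x ∈ D j → i = j) {A : Set ℕ} (hA : A.Infinite) {δ : ℝ} (hδ : 0 < δ) :
    ∃ n ∈ A, ∃ U : Set X, IsOpen U ∧ ↑(D n) ⊆ U ∧ ∃ A' ⊆ A, A'.Infinite ∧
      ∀ j ∈ A', n < j ∧ signMeasureMass (lam j) (closure U) < δ := by
  obtain ⟨N, hN⟩ := exists_nat_gt (1 / δ)
  rw [div_lt_iff₀ hδ] at hN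
  obtain ⟨I, hIA, hIN⟩ := hA.exists_subset_card_eq N
  obtain ⟨U, hU, hUd⟩ := exists_isOpen_disjoint_closures hD I
  have hex : ∀ j, ∃ i ∈ I, signMeasureMass (lam j) (closure (U i)) < δ := by
    intro j
    by_contra! h
    have h1 := Finset.card_nsmul_le_sum I _ δ h
    have h2 := sum_signMeasureMass_le (lam j) I (fun i => closure (U i)) hUd
    rw [hlam] at h2
    rw [hIN, nsmul_eq_mul] at h1
    linarith
  have hinf : ∃ i ∈ I, {j ∈ A | i < j ∧ signMeasureMass (lam j) (closure (U i)) < δ}.Infinite := by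
    by_contra! h
    apply hA
    have hfin : (Set.Iic (I.sup id) ∪
        ⋃ i ∈ I, {j ∈ A | i < j ∧ signMeasureMass (lam j) (closure (U i)) < δ}).Finite :=
      (Set.finite_Iic _).union
        (Set.Finite.biUnion I.finite_toSet fun i hi => h i hi)
    refine hfin.subset fun j hj => ?_
    obtain ⟨i, hi, hij⟩ := hex j
    by_cases hjI : j ≤ I.sup id
    · exact Or.inl hjI
    · refine Or.inr (Set.mem_biUnion hi ⟨hj, ?_, hij⟩)
      exact (Finset.le_sup (f := id) hi).trans_lt (not_le.1 hjI)
  obtain ⟨i, hi, hinf⟩ := hinf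
  exact ⟨i, hIA hi, U i, (hU i hi).1, (hU i hi).2, _, fun j hj => hj.1, hinf, fun j hj => hj.2⟩

/-- The pigeonhole selection is iterated along a decreasing sequence of infinite index sets, so
every later index is good for all earlier open sets. -/
theorem exists_subseq_isOpen_mass_lt {X : Type*} [TopologicalSpace X] [T3Space X]
    {lam : ℕ → X →₀ ℝ} (hlam : ∀ n, signMeasureNorm (lam n) = 1) {D : ℕ → Finset X}
    (hD : ∀ i j, ∀ x ∈ D i, x ∈ D j → i = j) {δ : ℕ → ℝ} (hδ : ∀ k, 0 < δ k) :
    ∃ ψ : ℕ → ℕ, StrictMono ψ ∧ ∃ U : ℕ → Set X, (∀ k, IsOpen (U k)) ∧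
      (∀ k, ↑(D (ψ k)) ⊆ U k) ∧
      ∀ k j, k < j → signMeasureMass (lam (ψ j)) (closure (U k)) < δ k := by
  have h : ∀ (A : {A : Set ℕ // A.Infinite}) (k : ℕ), ∃ n ∈ A.1, ∃ U : Set X, IsOpen U ∧
      ↑(D n) ⊆ U ∧ ∃ A' : {A : Set ℕ // A.Infinite}, A'.1 ⊆ A.1 ∧
      ∀ j ∈ A'.1, n < j ∧ signMeasureMass (lam j) (closure U) < δ k := by
    intro A k
    obtain ⟨n, hn, U, hU, hDU, A', hA', hinf, h⟩ :=
      exists_isOpen_infinite_mass_lt hlam hD A.2 (hδ k)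
    exact ⟨n, hn, U, hU, hDU, ⟨A', hinf⟩, hA', h⟩
  choose n hn U hU hDU A' hA' hmass using h
  let A : ℕ → {A : Set ℕ // A.Infinite} := fun k =>
    Nat.rec ⟨Set.univ, Set.infinite_univ⟩ (fun k B => A' B k) k
  have hanti : Antitone fun k => (A k).1 := antitone_nat_of_succ_le fun k => hA' (A k) k
  have hmem : ∀ k j, k < j → n (A j) j ∈ (A' (A k) k).1 := fun k j hkj =>
    hanti (Nat.succ_le_of_lt hkj) (hn (A j) j)
  exact ⟨fun k => n (A k) k, fun k j hkj => (hmass _ _ _ (hmem k j hkj)).1,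
    fun k => U (A k) k, fun k => hU _ _, fun k => hDU _ _,
    fun k j hkj => (hmass _ _ _ (hmem k j hkj)).2⟩

/-! ### From the JNP to a complemented `c₀` -/

theorem HasJNP.exists_complemented_cZero {X : Type*} [TopologicalSpace X] [T35Space X]
    (h : HasJNP X) :
    ∃ S : Submodule ℝ (Cp X), S.ClosedComplemented ∧ Nonempty (S ≃L[ℝ] cZero) := by
  classical
  obtain ⟨lam₀, hnorm₀, hnull₀, hpt⟩ := h.exists_pointwise_null
  obtain ⟨ψ₀, hψ₀, hhump⟩ := exists_subseq_mass_support_lt hpt (show (0 : ℝ) < 1 / 8 by norm_num)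
  let lam₁ : ℕ → X →₀ ℝ := fun k => lam₀ (ψ₀ k)
  let D : ℕ → Finset X := fun k =>
    (lam₁ k).support \ (Finset.range k).biUnion fun j => (lam₁ j).support
  have hDsupp : ∀ i j, i < j → ∀ x ∈ D j, x ∉ (lam₁ i).support := by
    intro i j hij x hx hxi
    exact (Finset.mem_sdiff.1 hx).2 (Finset.mem_biUnion.2 ⟨i, Finset.mem_range.2 hij, hxi⟩)
  have hD : ∀ i j, ∀ x ∈ D i, x ∈ D j → i = j := by
    intro i j x hi hj
    rcases lt_trichotomy i j with hij | hij | hij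
    · exact absurd (Finset.mem_sdiff.1 hi).1 (hDsupp i j hij x hj)
    · exact hij
    · exact absurd (Finset.mem_sdiff.1 hj).1 (hDsupp j i hij x hi)
  -- The sum 1/8 plus the hump error 1/8 leaves at most 1/4 of the mass uncontrolled, hence diagonal
  -- values at least `1 - 2 / 4`. Normalizing at most doubles the `δ j`, whose sum then stays below
  -- 1/2.
  let δ : ℕ → ℝ := fun k => 1 / 16 * (1 / 2) ^ k
  have hδsum : HasSum δ (1 / 8) := by
    have := hasSum_geometric_two.mul_left (1 / 16 : ℝ)
    norm_num at this
    simpa [δ] using this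
  obtain ⟨ψ, hψ, U, hUo, hDU, hUmass⟩ := exists_subseq_isOpen_mass_lt (lam := lam₁)
    (fun n => hnorm₀ _) hD (δ := δ) fun k => by positivity
  let lam : ℕ → X →₀ ℝ := fun k => lam₁ (ψ k)
  have hnull : ∀ f : Cp X, Tendsto (fun n => signMeasureEval (lam n) f) atTop (𝓝 0) := fun f =>
    (hnull₀ f).comp (hψ₀.comp hψ).tendsto_atTop
  -- Removing earlier closures makes the `V k` disjoint; removing earlier supports makes the matrix
  -- vanish above the diagonal.
  let V : ℕ → Set X := fun k =>
    U k \ ⋃ j ∈ Finset.range k, closure (U j) ∪ ↑(lam j).support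
  have hVo : ∀ k, IsOpen (V k) := fun k => (hUo k).sdiff <|
    (Finset.range k).finite_toSet.isClosed_biUnion fun j _ =>
      isClosed_closure.union (lam j).support.finite_toSet.isClosed
  have hVU : ∀ k, V k ⊆ closure (U k) := fun k => Set.sdiff_subset.trans subset_closure
  have hVd : ∀ i j, i < j → ∀ x ∈ V j, x ∉ closure (U i) ∧ x ∉ (lam i).support := by
    intro i j hij x hx
    have := hx.2
    simp only [Set.mem_iUnion, not_exists] at this
    have := this i (Finset.mem_range.2 hij)
    exact ⟨fun h => this (Or.inl h), fun h => this (Or.inr h)⟩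
  have hf : ∀ k, ∃ f : X → ℝ, Continuous f ∧ (∀ x, |f x| ≤ 1) ∧
      (∀ x ∈ (D (ψ k)).filter (· ∈ V k), lam k x * f x = |lam k x|) ∧ ∀ x ∉ V k, f x = 0 :=
    fun k => exists_continuous_sign_on_finset _ (hVo k) (fun x hx => by simp at hx; exact hx.2) _
  choose f hfc hf1 hfs hf0 using hf
  have hmass : ∀ k, signMeasureMass (lam k) {x | x ∈ (D (ψ k)).filter (· ∈ V k)}ᶜ ≤ 1 / 4 := by
    intro k
    have h1 : signMeasureMass (lam k) {x | x ∈ (D (ψ k)).filter (· ∈ V k)}ᶜ ≤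
        signMeasureMass (lam k) ((⋃ j ∈ Finset.range (ψ k), ↑(lam₀ (ψ₀ j)).support) ∪
          ⋃ j ∈ Finset.range k, closure (U j)) := by
      -- A support point outside the good set lies in an earlier support or an earlier closure;
      -- points of `D (ψ k)` already avoid the supports removed in `V k`.
      refine signMeasureMass_congr _ fun x hx hxD => ?_
      by_contra hcon
      simp only [Set.mem_union, Set.mem_iUnion, not_or, not_exists] at hcon
      have hxD' : x ∈ D (ψ k) := Finset.mem_sdiff.2 ⟨hx, fun h => by
        obtain ⟨j, hj, hxj⟩ := Finset.mem_biUnion.1 h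
        exact hcon.1 j hj hxj⟩
      refine hxD (Finset.mem_filter.2 ⟨hxD', hDU k hxD', fun h => ?_⟩)
      obtain ⟨j, hj, hxj⟩ := Set.mem_iUnion₂.1 h
      rcases hxj with hxj | hxj
      · exact hcon.2 j hj hxj
      · exact hDsupp _ _ (hψ (Finset.mem_range.1 hj)) x hxD' hxj
    have h2 := signMeasureMass_union_le (lam k)
      (⋃ j ∈ Finset.range (ψ k), ↑(lam₀ (ψ₀ j)).support) (⋃ j ∈ Finset.range k, closure (U j))
    have h3 := signMeasureMass_biUnion_le (lam k) (Finset.range k) fun j => closure (U j)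
    have h4 : ∑ j ∈ Finset.range k, signMeasureMass (lam k) (closure (U j)) ≤
        ∑ j ∈ Finset.range k, δ j :=
      Finset.sum_le_sum fun j hj => (hUmass j k (Finset.mem_range.1 hj)).le
    have h5 := sum_le_hasSum (Finset.range k)
      (fun j _ => show 0 ≤ δ j by positivity) hδsum
    have h6 : signMeasureMass (lam k) _ < 1 / 8 := hhump (ψ k)
    linarith
  have hc : ∀ k, 1 / 2 ≤ signMeasureEval (lam k) (f k) := by
    intro k
    have h1 := signMeasureNorm_sub_le_eval (lam k) (hf1 k)
      (D := {x | x ∈ (D (ψ k)).filter (· ∈ V k)}) (hfs k)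
    have h2 : signMeasureNorm (lam k) = 1 := hnorm₀ _
    linarith [hmass k]
  set c : ℕ → ℝ := fun k => signMeasureEval (lam k) (f k) with hcdef
  have hc0 : ∀ k, 0 < c k := fun k => by linarith [hc k]
  have hcinv : ∀ k, |(c k)⁻¹| ≤ 2 := fun k => by
    rw [abs_of_pos (inv_pos.2 (hc0 k))]
    exact inv_le_of_inv_le₀ two_pos (by simpa using hc k)
  have heval : ∀ k j, signMeasureEval (lam k) (fun x => (c j)⁻¹ * f j x) =
      (c j)⁻¹ * signMeasureEval (lam k) (f j) := by
    intro k j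
    simp only [signMeasureEval_eq_sum, Finset.mul_sum, mul_left_comm]
  refine exists_complemented_cZero_of_triangular (φ := fun k x => (c k)⁻¹ * f k x)
    (fun k => continuous_const.mul (hfc k)) (C := 2) (fun k x => ?_) ?_ hnull (fun k => ?_)
    (fun k j hkj => ?_) (b := fun j => 2 * δ j) (fun k j hjk => ?_) (hδsum.summable.mul_left 2) ?_
  · rw [abs_mul]
    nlinarith [hcinv k, hf1 k x, abs_nonneg ((c k)⁻¹), abs_nonneg (f k x)]
  · have hV : ∀ x k, (c k)⁻¹ * f k x ≠ 0 → x ∈ V k := fun x k h =>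
      by_contra fun hx => h (by rw [hf0 k x hx, mul_zero])
    intro x m n hm hn
    have hm' := hV x m hm
    have hn' := hV x n hn
    rcases lt_trichotomy m n with hmn | hmn | hmn
    · exact absurd (hVU m hm') (hVd m n hmn x hn').1
    · exact hmn
    · exact absurd (hVU n hn') (hVd n m hmn x hm').1
  · rw [heval]
    exact inv_mul_cancel₀ (hc0 k).ne'
  · rw [heval, signMeasureEval_eq_sum, Finset.sum_eq_zero, mul_zero]
    intro x hx
    rw [hf0 j x fun h => (hVd k j hkj x h).2 hx, mul_zero]
  · rw [heval, abs_mul]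
    have h1 := abs_signMeasureEval_le_mass (lam k) (hf1 j) (hf0 j)
    have h2 := (signMeasureMass_mono (lam k) (hVU j)).trans (hUmass j k hjk).le
    exact mul_le_mul (hcinv j) (by linarith) (abs_nonneg _) two_pos.le
  · rw [(hδsum.mul_left 2).tsum_eq]
    norm_num

/-! ### The equivalence -/

theorem corollary2p3 (X : Type*) [TopologicalSpace X] [T35Space X] :
    List.TFAE [
      ∃ Z : Submodule ℝ (Cp X), IsClosed (Z : Set (Cp X)) ∧
        ¬ FiniteDimensional ℝ (Cp X ⧸ Z) ∧ IsPolishable (Cp X ⧸ Z),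
      ∃ S : Submodule ℝ (Cp X), S.ClosedComplemented ∧
        ¬ FiniteDimensional ℝ S ∧ IsPolishable S,
      ∃ S : Submodule ℝ (Cp X), S.ClosedComplemented ∧
        (Nonempty (S ≃L[ℝ] (ℕ → ℝ)) ∨ Nonempty (S ≃L[ℝ] cZero)),
      ¬ IsPseudocompactSpace X ∨ HasJNP X] := by
  tfae_have 3 → 2 := by
    rintro ⟨S, hS, ⟨⟨e⟩⟩ | ⟨⟨e⟩⟩⟩
    · exact ⟨S, hS, fun h => not_finiteDimensional_pi_nat (Module.Finite.equiv e.toLinearEquiv),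
        isPolishable_pi_nat.of_linearEquiv e.symm.toLinearEquiv e.symm.continuous⟩
    · exact ⟨S, hS, fun h => not_finiteDimensional_cZero (Module.Finite.equiv e.toLinearEquiv),
        isPolishable_cZero.of_linearEquiv e.symm.toLinearEquiv e.symm.continuous⟩
  tfae_have 2 → 1 := by
    rintro ⟨S, hS, hfin, hpol⟩
    exact exists_polishable_quotient hS hfin hpol
  tfae_have 1 → 4 := by
    rintro ⟨Z, hZ, hfin, hpol⟩
    by_cases hX : IsPseudocompactSpace X
    · exact Or.inr (hasJNP_of_isPolishable_quotient hX.bounded hZ hfin hpol)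
    · exact Or.inl hX
  tfae_have 4 → 3 := by
    rintro (hX | hX)
    · obtain ⟨f, hf, hf'⟩ : ∃ f : X → ℝ, Continuous f ∧ ∀ M : ℝ, ∃ x, M < |f x| := by
        -- Since `X` is Tychonoff, pseudocompactness can fail only through an unbounded function.
        by_contra! h
        exact hX ⟨inferInstance, h⟩
      obtain ⟨S, hS, e⟩ := exists_complemented_pi_nat hf hf'
      exact ⟨S, hS, Or.inl e⟩
    · obtain ⟨S, hS, e⟩ := hX.exists_complemented_cZero
      exact ⟨S, hS, Or.inr e⟩
  tfae_finish
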